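/- Let $p>2$ be a prime, let $F$ be an infinite field of characteristic $p$, and let $k\ge 0$ be an integer. Let $L$ be an $F$-vector space with basis $e_1,e_2,\dots$ and let $E$ be its (unital, infinite dimensional) Grassmann algebra. Let $E^{k^*}=\bigoplus_{n\in\mathbb Z}A_n$ denote $E$ with the $\mathbb Z$-grading in which $e_1,\dots,e_k$ have degree $1$, all $e_i$ with $i>k$ have degree $0$, and a product $e_{j_1}\cdots e_{j_s}$ has degree the sum of the degrees of its factors. Let $F\langle X\mid\mathbb Z\rangle$ be the free unital associative algebra on the variables $x^{i}_{j}$ ($i\in\mathbb Z$, with countably many variables for each $i$), graded by giving $x^i_j$ the degree $\alpha(x^i_j)=i$. A polynomial $f\in F\langle X\mid\mathbb Z\rangle$ is a $\mathbb Z$-graded polynomial identity of $E^{k^*}$ if it vanishes whenever each of its variables $x$ is replaced by an element of $A_{\alpha(x)}$. A $T_{\mathbb Z}$-ideal is a two-sided ideal of $F\langle X\mid\mathbb Z\rangle$ that is invariant under all graded algebra endomorphisms. Let $T_{\mathbb Z}(E^{k^*})$ be the $T_{\mathbb Z}$-ideal of all $\mathbb Z$-graded polynomial identities of $E^{k^*}$.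 Write $[a,b]=ab-ba$ and $[a,b,c]=[[a,b],c]$. **Theorem.** 1. If $p>k$, then $T_{\mathbb Z}(E^{k^*})$ is generated, as a $T_{\mathbb Z}$-ideal, by the polynomials * $x$, for the variables $x$ with $\alpha(x)\notin\{0,1,\dots,k\}$; * $[x_1,x_2,x_3]$, for every choice of the degrees $\alpha(x_1),\alpha(x_2),\alpha(x_3)\in\mathbb Z$. 2. If $p\le k$, then $T_{\mathbb Z}(E^{k^*})$ is generated, as a $T_{\mathbb Z}$-ideal, by these two families together with the polynomials * $x^p$, for the variables $x$ of degree $\alpha(x)=t$ with $t\in\{1,\dots,k\}$ and $pt\le k$. -/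

import Mathlib

/-! ### The free `ℤ`-graded associative algebra `F⟨X | ℤ⟩` and `T_ℤ`-ideals -/

/-- The free unital associative algebra on the variables `x_j^i`, indexed by the pairs `(i, j)`
with `i : ℤ` the degree of the variable and `j : ℕ` its name. -/
abbrev FreeZAlgebra (F : Type*) [Field F] : Type _ := FreeAlgebra F (ℤ × ℕ)

/-- The variable of degree `i` with name `j`. -/
def gvar (F : Type*) [Field F] (i : ℤ) (j : ℕ) : FreeZAlgebra F := FreeAlgebra.ι F (i, j)

/-- The homogeneous component of degree `n` of the free graded algebra: the span of all monomials
whose variables have degrees adding up to `n`. -/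
def freeComponent (F : Type*) [Field F] (n : ℤ) : Submodule F (FreeZAlgebra F) :=
  Submodule.span F
    {w | ∃ l : List (ℤ × ℕ), (l.map Prod.fst).sum = n ∧
      w = (l.map fun v => gvar F v.1 v.2).prod}

/-- `φ` is a `ℤ`-graded endomorphism of the free graded algebra. -/
def IsGradedEndomorphism {F : Type*} [Field F] (φ : FreeZAlgebra F →ₐ[F] FreeZAlgebra F) : Prop :=
  ∀ n : ℤ, ∀ f ∈ freeComponent F n, φ f ∈ freeComponent F n

/-- A `T_ℤ`-ideal is a two-sided ideal that is invariant under all `ℤ`-graded endomorphisms. -/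
def IsTZIdeal {F : Type*} [Field F] (I : TwoSidedIdeal (FreeZAlgebra F)) : Prop :=
  ∀ φ : FreeZAlgebra F →ₐ[F] FreeZAlgebra F, IsGradedEndomorphism φ → ∀ f ∈ I, φ f ∈ I

/-- The `T_ℤ`-ideal generated by `S`: the least `T_ℤ`-ideal that contains `S`. Its elements are
the consequences of the graded polynomials in `S`. -/
def tzIdealSpan {F : Type*} [Field F] (S : Set (FreeZAlgebra F)) :
    TwoSidedIdeal (FreeZAlgebra F) :=
  sInf {I | IsTZIdeal I ∧ S ⊆ (I : Set (FreeZAlgebra F))}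

/-! ### Graded identities -/

/-- `f` vanishes under every substitution of elements of the right degrees for its variables;
`A n` is the component of degree `n`. -/
def IsGradedIdentity {F R : Type*} [Field F] [Ring R] [Algebra F R] (A : ℤ → Submodule F R)
    (f : FreeZAlgebra F) : Prop :=
  ∀ a : ℤ × ℕ → R, (∀ v, a v ∈ A v.1) → FreeAlgebra.lift F a f = 0

/-- The ideal `T_ℤ(A)` of all `ℤ`-graded polynomial identities. -/
def gradedIdentities {F R : Type*} [Field F] [Ring R] [Algebra F R] (A : ℤ → Submodule F R) :
    TwoSidedIdeal (FreeZAlgebra F) :=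
  TwoSidedIdeal.mk' {f | IsGradedIdentity A f}
    (show IsGradedIdentity A 0 from fun _ _ => map_zero _)
    (fun {x y} (hx : IsGradedIdentity A x) (hy : IsGradedIdentity A y) =>
      show IsGradedIdentity A (x + y) from fun a ha => by rw [map_add, hx a ha, hy a ha, add_zero])
    (fun {x} (hx : IsGradedIdentity A x) =>
      show IsGradedIdentity A (-x) from fun a ha => by rw [map_neg, hx a ha, neg_zero])
    (fun {x y} (hy : IsGradedIdentity A y) =>
      show IsGradedIdentity A (x * y) from fun a ha => by rw [map_mul, hy a ha, mul_zero])
    (fun {x y} (hx : IsGradedIdentity A x) =>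
      show IsGradedIdentity A (x * y) from fun a ha => by rw [map_mul, hx a ha, zero_mul])

theorem mem_gradedIdentities {F R : Type*} [Field F] [Ring R] [Algebra F R]
    (A : ℤ → Submodule F R) (f : FreeZAlgebra F) :
    f ∈ gradedIdentities A ↔ IsGradedIdentity A f :=
  TwoSidedIdeal.mem_mk' _ _ _ _ _ _ _

/-! ### The Grassmann algebra and its grading `E^{k*}` -/

/-- The `ℤ`-grading on the Grassmann algebra of `L` given by the degrees `d i` of the elements
`e i` of a basis of `L`. A product of the `e i` has as degree the sum of the degrees of its factors,
and the component of degree `n` is spanned by the products of degree `n`. (A product with a repeated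
factor is zero, and reordering the factors only changes the sign, so that these products and those
with strictly increasing indices have the same span.) -/
def grassmannComponent {F L : Type*} [Field F] [AddCommGroup L] [Module F L]
    (e : Module.Basis ℕ F L) (d : ℕ → ℤ) (n : ℤ) : Submodule F (ExteriorAlgebra F L) :=
  Submodule.span F
    {w | ∃ l : List ℕ, (l.map d).sum = n ∧
      w = (l.map fun i => ExteriorAlgebra.ι F (e i)).prod}

/-- The components of `E^{k*}`: the first `k` basis elements, here `e 0, …, e (k - 1)`,
have degree `1`, all others have degree `0`. -/
def kStarComponent {F L : Type*} [Field F] [AddCommGroup L] [Module F L]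
    (e : Module.Basis ℕ F L) (k : ℕ) : ℤ → Submodule F (ExteriorAlgebra F L) :=
  grassmannComponent e fun i => if i < k then 1 else 0

/-! ### The generating identities -/

/-- The variables `x` of degree outside `{0, …, k}`. -/
def outerVariables (F : Type*) [Field F] (k : ℕ) : Set (FreeZAlgebra F) :=
  {f | ∃ (i : ℤ) (j : ℕ), i ∉ Set.Icc (0 : ℤ) k ∧ f = gvar F i j}

/-- The triple commutators `[x₁, x₂, x₃] = [[x₁, x₂], x₃]`, for all choices of the degrees. -/
def tripleCommutators (F : Type*) [Field F] : Set (FreeZAlgebra F) :=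
  {f | ∃ i₁ i₂ i₃ : ℤ, f = ⁅⁅gvar F i₁ 1, gvar F i₂ 2⁆, gvar F i₃ 3⁆}

/-- The powers `x ^ p` for the variables `x` of degree `t ∈ {1, …, k}` with `p t ≤ k`. -/
def powerIdentities (F : Type*) [Field F] (p k : ℕ) : Set (FreeZAlgebra F) :=
  {f | ∃ t j : ℕ, t ∈ Finset.Icc 1 k ∧ p * t ≤ k ∧ f = gvar F t j ^ p}

/-!
Let `I` be the `T_ℤ`-ideal generated by all three families; for `k < p` the family of the `p`-th
powers is empty, so both parts of the theorem say that `I` is the ideal of graded identities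
of `E^{k*}`.

The generators are identities (`tzIdealSpan_le_gradedIdentities`). Every element of `E` is a sum
`z + w` with `z` central and `w` odd, odd elements anticommute, and `⁅z + w, z' + w'⁆ = 2 w w'` is
central. If the degree is positive, then `z` is a sum of central elements of square zero, and
`(z + w) ^ p = z ^ p + w ^ p = 0` by additivity of the Frobenius map.

Conversely, modulo `I` all commutators are central, whence `⁅a, b⁆ ⁅c, d⁆ = -⁅a, c⁆ ⁅b, d⁆`: a
product of commutators is alternating in its entries (`commProd_perm`, `commProd_of_not_nodup`).
Reordering the letters of a word produces only shorter words times commutators. Hence the normal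
words, indexed by a multiset `a` of letters and a finite set `J` of entries of commutators, span the
quotient (`word_mem_of_forall_exists`). The relations in `I` leave only the admissible ones:
`J` of even size, nonnegative degrees, total degree at most `k`, and fewer than `p` occurrences in
`a` of each variable of positive degree (`exists_sub_linearCombination_mem`).

The admissible normal words are independent modulo the identities of `E^{k*}`
(`eq_zero_of_isGradedIdentity_linearCombination`). Given a nontrivial combination, take a pair
`(a, J)` in it with `J` of least size, and substitute `z v + x v` for the variable `v`, where `x v`
is an odd product of basis vectors for `v ∈ J` and `0` otherwise, while `z v` is `1` in degree `0` and
otherwise a sum of as many even products as `v` has occurrences in `a`. The bound `k` on the total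
degree leaves room to choose all these products disjoint (`exists_disjoint_finsets`), and the value
of the word is a product of distinct basis vectors times a power of `2` and factorials `n!` with
`n < p`, so it is nonzero (`exists_normalWord_ne_zero`). Words with another commutator part than `J`
vanish there, since one of their commutators has a central entry, and those with the same `J` are
separated by their multidegrees, since `F` is infinite.
-/

/-! ### Rings in which all commutators are central -/

section CentralCommutators

variable {R : Type*} [Ring R]

/-- The product `⁅a₁, a₂⁆ * ⁅a₃, a₄⁆ * ⋯` of the commutators of consecutive entries of a list.
It is set to `0` on lists of odd length, so that permutations of the list change it by a sign
whatever the length. -/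
def commProd : List R → R
  | [] => 1
  | [_] => 0
  | a :: b :: l => ⁅a, b⁆ * commProd l

theorem map_commProd {S : Type*} [Ring S] (f : R →+* S) :
    ∀ l : List R, f (commProd l) = commProd (l.map f)
  | [] => by simp [commProd]
  | [_] => by simp [commProd]
  | a :: b :: l => by simp [commProd, map_commProd f l, Ring.lie_def]

theorem commProd_of_odd : ∀ l : List R, Odd l.length → commProd l = 0
  | [], h => by simp at h
  | [_], _ => rfl
  | a :: b :: l, h => by
    have h' : Odd l.length := by
      simp only [List.length_cons] at h
      grind
    simp [commProd, commProd_of_odd l h']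

variable (hR : ∀ a b c : R, ⁅⁅a, b⁆, c⁆ = 0)
include hR

theorem lie_mul_comm (a b c : R) : ⁅a, b⁆ * c = c * ⁅a, b⁆ := by
  have := hR a b c
  rwa [Ring.lie_def, sub_eq_zero] at this

/-- Expanding `⁅⁅a, b * c⁆, d⁆ = 0` by the Leibniz rule. -/
theorem lie_mul_lie_swap (a b c d : R) : ⁅a, b⁆ * ⁅c, d⁆ = -(⁅a, c⁆ * ⁅b, d⁆) := by
  have key : ⁅⁅a, b * c⁆, d⁆ = ⁅a, b⁆ * ⁅c, d⁆ + ⁅⁅a, b⁆, d⁆ * c + b * ⁅⁅a, c⁆, d⁆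
      + ⁅b, d⁆ * ⁅a, c⁆ := by
    simp only [Ring.lie_def]; noncomm_ring
  rw [hR, hR, hR, lie_mul_comm hR b d] at key
  rw [eq_neg_iff_add_eq_zero]
  simpa using key.symm

theorem commProd_append_swap (x y : R) (l : List R) :
    ∀ pre : List R, commProd (pre ++ x :: y :: l) = -commProd (pre ++ y :: x :: l)
  | [] => by simp [commProd, Ring.lie_def, ← neg_mul]
  | [a] => by
    cases l with
    | nil => simp [commProd]
    | cons b l =>
      simp only [List.singleton_append, commProd, ← mul_assoc]
      rw [lie_mul_lie_swap hR, neg_mul]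
  | a :: b :: pre => by
    simp [commProd, commProd_append_swap x y l pre]

theorem commProd_append_perm {l₁ l₂ : List R} (h : l₁.Perm l₂) : ∀ pre : List R,
    commProd (pre ++ l₁) = commProd (pre ++ l₂) ∨
      commProd (pre ++ l₁) = -commProd (pre ++ l₂) := by
  induction h with
  | nil => exact fun _ => Or.inl rfl
  | cons a _ ih => exact fun pre => by simpa using ih (pre ++ [a])
  | swap x y l => exact fun pre => Or.inr (commProd_append_swap hR y x l pre)
  | trans _ _ ih₁ ih₂ =>
    intro pre
    rcases ih₁ pre with h₁ | h₁ <;> rcases ih₂ pre with h₂ | h₂ <;> simp [h₁, h₂]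

theorem commProd_perm {l₁ l₂ : List R} (h : l₁.Perm l₂) :
    commProd l₁ = commProd l₂ ∨ commProd l₁ = -commProd l₂ :=
  commProd_append_perm hR h []

theorem commProd_eq_zero_of_perm {l₁ l₂ : List R} (h : l₁.Perm l₂) (h₂ : commProd l₂ = 0) :
    commProd l₁ = 0 := by
  rcases commProd_perm hR h with h' | h' <;> simp [h', h₂]

theorem commProd_of_not_nodup {l : List R} (h : ¬ l.Nodup) : commProd l = 0 := by
  obtain ⟨x, hx⟩ := List.exists_duplicate_iff_not_nodup.2 h
  obtain ⟨l', hl'⟩ := (List.duplicate_iff_sublist.1 hx).exists_perm_append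
  exact commProd_eq_zero_of_perm hR hl' (by simp [commProd, Ring.lie_def])

/-- A product of commutators vanishes as soon as one entry is central. -/
theorem commProd_of_mem_center {l : List R} {z : R} (hz : z ∈ l) (hc : ∀ r, Commute z r) :
    commProd l = 0 := by
  obtain ⟨l', hl'⟩ := (List.singleton_sublist.2 hz).exists_perm_append
  refine commProd_eq_zero_of_perm hR hl' ?_
  cases l' with
  | nil => rfl
  | cons b l' => simp [commProd, Ring.lie_def, (hc b).eq]

variable {σ F : Type*} [CommRing F] [Algebra F R] (V : Submodule F R) (x : σ → R)

/-- Reordering the factors of a word changes it by words with fewer letters times commutators. -/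
theorem word_sub_word_mem {l₁ l₂ : List σ} (h : l₁.Perm l₂) : ∀ pre : List σ,
    (∀ w u : List σ, w.length < pre.length + l₁.length →
      (w.map x).prod * commProd (u.map x) ∈ V) → ∀ u : List σ,
    ((pre ++ l₁).map x).prod * commProd (u.map x)
      - ((pre ++ l₂).map x).prod * commProd (u.map x) ∈ V := by
  induction h with
  | nil => simp
  | cons a _ ih =>
    intro pre H u
    have := ih (pre ++ [a]) (fun w u hw => H w u (by simp at hw ⊢; omega)) u
    simpa using this
  | swap a b l =>
    intro pre H u
    have := H (pre ++ l) (b :: a :: u) (by simp)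
    convert this using 1
    simp only [List.map_append, List.map_cons, List.prod_append, List.prod_cons, commProd]
    have h1 := lie_mul_comm hR (x b) (x a) (l.map x).prod
    calc _ = (pre.map x).prod * (⁅x b, x a⁆ * (l.map x).prod) * commProd (u.map x) := by
          rw [Ring.lie_def]; noncomm_ring
      _ = _ := by rw [h1]; noncomm_ring
  | trans h₁ _ ih₁ ih₂ =>
    intro pre H u
    have := V.add_mem (ih₁ pre H u) (ih₂ pre (by rwa [← h₁.length_eq]) u)
    simpa using this

/-- If every pair `(a, J)` of a multiset and a finite set has, for one ordering of `a`, its product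
in `V`, then `V` contains all words. -/
theorem word_mem_of_forall_exists [DecidableEq σ]
    (H : ∀ (a : Multiset σ) (J : Finset σ), ∃ l : List σ, (l : Multiset σ) = a ∧
      (l.map x).prod * commProd (J.toList.map x) ∈ V) (l u : List σ) :
    (l.map x).prod * commProd (u.map x) ∈ V := by
  induction hn : l.length using Nat.strong_induction_on generalizing l u with
  | _ n ih =>
    subst hn
    by_cases hu : u.Nodup
    · have hp : (u.map x).Perm (u.toFinset.toList.map x) :=
        ((List.toFinset_toList hu).symm).map x
      obtain ⟨l', hl', hmem⟩ := H l u.toFinset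
      have hmem' : (l'.map x).prod * commProd (u.map x) ∈ V := by
        rcases commProd_perm hR hp with h | h
        · rwa [h]
        · rw [h, mul_neg]; exact V.neg_mem hmem
      have := word_sub_word_mem hR V x (Multiset.coe_eq_coe.1 hl'.symm) []
        (fun w u hw => ih w.length (by simpa using hw) w u rfl) u
      have := V.add_mem this hmem'
      simpa using this
    · obtain ⟨y, hy⟩ := List.exists_duplicate_iff_not_nodup.2 hu
      have h2 : (List.Sublist [x y, x y] (u.map x)) := by
        simpa using (List.duplicate_iff_sublist.1 hy).map x
      have h3 : ¬ (u.map x).Nodup :=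
        List.exists_duplicate_iff_not_nodup.1 ⟨_, List.duplicate_iff_sublist.2 h2⟩
      rw [commProd_of_not_nodup hR h3, mul_zero]
      exact V.zero_mem

end CentralCommutators

/-! ### The Grassmann algebra -/

theorem two_ne_zero_of_two_lt_charP {F : Type*} [Field F] (p : ℕ) (hp2 : 2 < p) [CharP F p] :
    (2 : F) ≠ 0 := by
  intro h
  have : p ∣ 2 := (CharP.cast_eq_zero_iff F p 2).1 (by exact_mod_cast h)
  exact absurd (Nat.le_of_dvd two_pos this) (by omega)

section Grassmann

variable {F L : Type*} [Field F] [AddCommGroup L] [Module F L] (e : Module.Basis ℕ F L)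

/-- The product of the basis vectors of `L` listed in `l`, in the Grassmann algebra. -/
noncomputable def wedge (l : List ℕ) : ExteriorAlgebra F L :=
  (l.map fun i => ExteriorAlgebra.ι F (e i)).prod

@[simp] theorem wedge_nil : wedge e [] = 1 := rfl

@[simp] theorem wedge_cons (i : ℕ) (l : List ℕ) :
    wedge e (i :: l) = ExteriorAlgebra.ι F (e i) * wedge e l := by simp [wedge]

theorem wedge_append (l₁ l₂ : List ℕ) : wedge e (l₁ ++ l₂) = wedge e l₁ * wedge e l₂ := by
  simp [wedge]

theorem wedge_flatMap {τ : Type*} (T : List τ) (f : τ → List ℕ) :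
    wedge e (T.flatMap f) = (T.map fun s => wedge e (f s)).prod := by
  induction T with
  | nil => rfl
  | cons s T ih => simp [wedge_append, ih]

theorem wedge_eq_ιMulti (l : List ℕ) :
    wedge e l = ExteriorAlgebra.ιMulti F l.length (fun i => e (l.get i)) := by
  rw [ExteriorAlgebra.ιMulti_apply, wedge]
  congr 1
  conv_lhs => rw [← List.ofFn_get l]
  rw [List.map_ofFn]
  rfl

theorem wedge_of_not_nodup {l : List ℕ} (h : ¬ l.Nodup) : wedge e l = 0 := by
  rw [wedge_eq_ιMulti]
  apply ExteriorAlgebra.ιMulti_eq_zero_of_not_inj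
  intro hinj
  exact h (List.nodup_iff_injective_get.2 fun i j hij => hinj (by simp only [hij]))

/-- A product of distinct basis vectors is nonzero: the determinant of the coordinates
at the indices in `l` takes the value `1` on it. -/
theorem wedge_ne_zero {l : List ℕ} (h : l.Nodup) : wedge e l ≠ 0 := by
  classical
  let f : ∀ n, L [⋀^Fin n]→ₗ[F] F := fun n =>
    (Matrix.detRowAlternating (n := Fin n) (R := F)).compLinearMap
      (LinearMap.pi fun a : Fin n => e.coord (l.getD a 0))
  have key : ExteriorAlgebra.liftAlternating f (wedge e l) = 1 := by
    rw [wedge_eq_ιMulti, ExteriorAlgebra.liftAlternating_apply_ιMulti]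
    change Matrix.det _ = 1
    rw [← Matrix.det_one (n := Fin l.length) (R := F)]
    congr 1
    ext b a
    have : l.getD a 0 = l.get a := by simp
    simp only [LinearMap.pi_apply, this, Module.Basis.coord_apply, Module.Basis.repr_self,
      Matrix.one_apply, Finsupp.single_apply]
    simp only [(List.nodup_iff_injective_get.1 h).eq_iff]
  intro h0
  simp [h0] at key

theorem ι_mul_wedge (i : ℕ) (l : List ℕ) : ExteriorAlgebra.ι F (e i) * wedge e l
    = (-1) ^ l.length * (wedge e l * ExteriorAlgebra.ι F (e i)) := by
  induction l with
  | nil => simp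
  | cons j l ih =>
    have hs : ExteriorAlgebra.ι F (e i) * ExteriorAlgebra.ι F (e j)
        = -(ExteriorAlgebra.ι F (e j) * ExteriorAlgebra.ι F (e i)) :=
      eq_neg_of_add_eq_zero_left (ExteriorAlgebra.ι_add_mul_swap _ _)
    have hc := (Commute.neg_one_left (ExteriorAlgebra.ι F (e j))).pow_left l.length
    rw [wedge_cons, ← mul_assoc, hs, neg_mul, mul_assoc, ih, ← mul_assoc _ ((-1) ^ _), ← hc.eq,
      List.length_cons, pow_succ]
    noncomm_ring

theorem wedge_mul_wedge (l₁ l₂ : List ℕ) : wedge e l₁ * wedge e l₂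
    = (-1) ^ (l₁.length * l₂.length) * (wedge e l₂ * wedge e l₁) := by
  induction l₁ with
  | nil => simp
  | cons i l ih =>
    have hc := ((Commute.neg_one_left (ExteriorAlgebra.ι F (e i))).pow_left
      (l.length * l₂.length))
    rw [wedge_cons, mul_assoc, ih, ← mul_assoc, ← hc.eq, mul_assoc, ← mul_assoc _ (wedge e l₂),
      ι_mul_wedge, List.length_cons, add_mul, pow_add, one_mul]
    noncomm_ring

theorem span_wedge : Submodule.span F (Set.range (wedge e)) = ⊤ := by
  rw [eq_top_iff]
  rintro x -
  induction x using ExteriorAlgebra.induction with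
  | algebraMap r =>
    rw [Algebra.algebraMap_eq_smul_one]
    exact Submodule.smul_mem _ _ (Submodule.subset_span ⟨[], rfl⟩)
  | ι m =>
    have hm : m ∈ Submodule.span F (Set.range e) := by rw [e.span_eq]; trivial
    induction hm using Submodule.span_induction with
    | mem _ h =>
      obtain ⟨i, rfl⟩ := h
      exact Submodule.subset_span ⟨[i], by simp⟩
    | zero => simp
    | add _ _ _ _ h₁ h₂ => rw [map_add]; exact Submodule.add_mem _ h₁ h₂
    | smul c _ _ h => rw [map_smul]; exact Submodule.smul_mem _ c h
  | mul a b ha hb =>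
    have := Submodule.mul_mem_mul ha hb
    rw [Submodule.span_mul_span] at this
    refine Submodule.span_mono ?_ this
    rintro _ ⟨_, ⟨l₁, rfl⟩, _, ⟨l₂, rfl⟩, rfl⟩
    exact ⟨l₁ ++ l₂, wedge_append e l₁ l₂⟩
  | add a b ha hb => exact Submodule.add_mem _ ha hb

/-- A linear statement about an element of the Grassmann algebra need only be checked on the
products of basis vectors. -/
theorem wedge_induction {P : ExteriorAlgebra F L → Prop} (x : ExteriorAlgebra F L)
    (hw : ∀ l, P (wedge e l)) (h0 : P 0) (hadd : ∀ x y, P x → P y → P (x + y))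
    (hsmul : ∀ (c : F) x, P x → P (c • x)) : P x := by
  have hx : x ∈ Submodule.span F (Set.range (wedge e)) := by rw [span_wedge]; trivial
  induction hx using Submodule.span_induction with
  | mem _ h => obtain ⟨l, rfl⟩ := h; exact hw l
  | zero => exact h0
  | add _ _ _ _ h₁ h₂ => exact hadd _ _ h₁ h₂
  | smul c _ _ h => exact hsmul c _ h

/-- Products of an even number of basis vectors are central. -/
theorem wedge_commute_of_even {l : List ℕ} (hl : Even l.length) (x : ExteriorAlgebra F L) :
    Commute (wedge e l) x := by
  induction x using wedge_induction e with
  | hw l' =>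
    have := wedge_mul_wedge e l l'
    rwa [(hl.mul_right _).neg_one_pow, one_mul] at this
  | h0 => exact Commute.zero_right _
  | hadd x y hx hy => exact hx.add_right hy
  | hsmul c x hx => exact hx.smul_right c

/-- The span of the products of an odd number of basis vectors. -/
noncomputable def oddSpan : Submodule F (ExteriorAlgebra F L) :=
  Submodule.span F {w | ∃ l : List ℕ, Odd l.length ∧ w = wedge e l}

theorem wedge_mem_oddSpan {l : List ℕ} (hl : Odd l.length) : wedge e l ∈ oddSpan e :=
  Submodule.subset_span ⟨l, hl, rfl⟩

theorem oddSpan_mul_comm {v w : ExteriorAlgebra F L} (hv : v ∈ oddSpan e) (hw : w ∈ oddSpan e) :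
    v * w = -(w * v) := by
  induction hv using Submodule.span_induction with
  | mem _ h =>
    obtain ⟨l₁, h₁, rfl⟩ := h
    induction hw using Submodule.span_induction with
    | mem _ h =>
      obtain ⟨l₂, h₂, rfl⟩ := h
      have := wedge_mul_wedge e l₁ l₂
      rwa [(h₁.mul h₂).neg_one_pow, neg_one_mul] at this
    | zero => simp
    | add _ _ _ _ h₁ h₂ => rw [mul_add, add_mul, h₁, h₂, neg_add]
    | smul c _ _ h => rw [mul_smul_comm, h, smul_mul_assoc, smul_neg]
  | zero => simp
  | add _ _ _ _ h₁ h₂ => rw [mul_add, add_mul, h₁, h₂, neg_add]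
  | smul c _ _ h => rw [mul_smul_comm, smul_mul_assoc, h, smul_neg]

theorem oddSpan_mul_commute {v w : ExteriorAlgebra F L} (hv : v ∈ oddSpan e) (hw : w ∈ oddSpan e)
    (x : ExteriorAlgebra F L) : Commute (v * w) x := by
  induction hv using Submodule.span_induction with
  | mem _ h =>
    obtain ⟨l₁, h₁, rfl⟩ := h
    induction hw using Submodule.span_induction with
    | mem _ h =>
      obtain ⟨l₂, h₂, rfl⟩ := h
      rw [← wedge_append]
      exact wedge_commute_of_even e (by simpa using h₁.add_odd h₂) x
    | zero => simp
    | add _ _ _ _ h₁ h₂ => rw [mul_add]; exact h₁.add_left h₂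
    | smul c _ _ h => rw [mul_smul_comm]; exact h.smul_left c
  | zero => simp
  | add _ _ _ _ h₁ h₂ => rw [add_mul]; exact h₁.add_left h₂
  | smul c _ _ h => rw [smul_mul_assoc]; exact h.smul_left c

theorem oddSpan_mul_self (h2 : (2 : F) ≠ 0) {w : ExteriorAlgebra F L} (hw : w ∈ oddSpan e) :
    w * w = 0 := by
  have h := oddSpan_mul_comm e hw hw
  have : (2 : F) • (w * w) = 0 := by
    rw [two_smul]; exact eq_neg_iff_add_eq_zero.1 h
  exact (smul_eq_zero.1 this).resolve_left h2

theorem exists_central_add_odd (x : ExteriorAlgebra F L) :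
    ∃ z w, (∀ y, Commute z y) ∧ w ∈ oddSpan e ∧ x = z + w := by
  induction x using wedge_induction e with
  | hw l =>
    rcases Nat.even_or_odd l.length with h | h
    · exact ⟨wedge e l, 0, wedge_commute_of_even e h, Submodule.zero_mem _, (add_zero _).symm⟩
    · exact ⟨0, wedge e l, Commute.zero_left, wedge_mem_oddSpan e h, (zero_add _).symm⟩
  | h0 => exact ⟨0, 0, Commute.zero_left, Submodule.zero_mem _, (add_zero _).symm⟩
  | hadd x y hx hy =>
    obtain ⟨z, w, hz, hw, rfl⟩ := hx
    obtain ⟨z', w', hz', hw', rfl⟩ := hy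
    exact ⟨z + z', w + w', fun y => (hz y).add_left (hz' y), Submodule.add_mem _ hw hw', by abel⟩
  | hsmul c x hx =>
    obtain ⟨z, w, hz, hw, rfl⟩ := hx
    exact ⟨c • z, c • w, fun y => (hz y).smul_left c, Submodule.smul_mem _ c hw, smul_add _ _ _⟩

/-- The commutator of two elements only sees their odd parts. -/
theorem lie_central_add_odd {z w z' w' : ExteriorAlgebra F L} (hz : ∀ y, Commute z y)
    (hw : w ∈ oddSpan e) (hz' : ∀ y, Commute z' y) (hw' : w' ∈ oddSpan e) :
    ⁅z + w, z' + w'⁆ = (2 : F) • (w * w') := by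
  have h := oddSpan_mul_comm e hw' hw
  have h₁ := (hz z').eq
  have h₂ := (hz w').eq
  have h₃ := (hz' w).eq
  simp only [Ring.lie_def, add_mul, mul_add, h, h₁, h₂, h₃, two_smul]
  abel

include e in
theorem lie_lie_eq_zero (a b c : ExteriorAlgebra F L) : ⁅⁅a, b⁆, c⁆ = 0 := by
  obtain ⟨z, w, hz, hw, rfl⟩ := exists_central_add_odd e a
  obtain ⟨z', w', hz', hw', rfl⟩ := exists_central_add_odd e b
  rw [lie_central_add_odd e hz hw hz' hw', Ring.lie_def, sub_eq_zero]
  exact (oddSpan_mul_commute e hw hw' c).smul_left (2 : F)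

theorem wedge_mem_kStarComponent (k : ℕ) {l : List ℕ} {n : ℤ}
    (h : (l.map fun i => if i < k then (1 : ℤ) else 0).sum = n) :
    wedge e l ∈ kStarComponent e k n :=
  Submodule.subset_span ⟨l, h, rfl⟩

theorem one_mem_kStarComponent (k : ℕ) : (1 : ExteriorAlgebra F L) ∈ kStarComponent e k 0 :=
  wedge_mem_kStarComponent e k (l := []) (by simp)

theorem mul_mem_kStarComponent (k : ℕ) {m n : ℤ} {x y : ExteriorAlgebra F L}
    (hx : x ∈ kStarComponent e k m) (hy : y ∈ kStarComponent e k n) :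
    x * y ∈ kStarComponent e k (m + n) := by
  have := Submodule.mul_mem_mul hx hy
  simp only [kStarComponent, grassmannComponent, Submodule.span_mul_span] at this ⊢
  refine Submodule.span_mono ?_ this
  rintro _ ⟨_, ⟨l₁, rfl, rfl⟩, _, ⟨l₂, rfl, rfl⟩, rfl⟩
  exact ⟨l₁ ++ l₂, by simp, by simp⟩

theorem sum_kStarDegree (k : ℕ) (l : List ℕ) :
    (l.map fun i => if i < k then (1 : ℤ) else 0).sum = (l.filter (· < k)).length := by
  induction l with
  | nil => rfl
  | cons i l ih =>
    by_cases h : i < k <;> simp [h, ih, add_comm]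

theorem kStarComponent_eq_bot (k : ℕ) {n : ℤ} (hn : n ∉ Set.Icc (0 : ℤ) k) :
    kStarComponent e k n = ⊥ := by
  rw [kStarComponent, grassmannComponent, Submodule.span_eq_bot]
  rintro _ ⟨l, hl, rfl⟩
  rw [sum_kStarDegree] at hl
  apply wedge_of_not_nodup
  intro hnd
  apply hn
  refine ⟨by omega, ?_⟩
  have h1 : (l.filter (· < k)).toFinset ⊆ Finset.range k := by
    intro i; simp
  have h2 := Finset.card_le_card h1
  rw [List.toFinset_card_of_nodup (hnd.filter _), Finset.card_range] at h2
  omega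

/-- An element of positive degree is a sum `z + w` with `z` a sum of central elements of square
zero and `w` odd, so that its `p`-th power vanishes by additivity of the Frobenius map. -/
theorem pow_eq_zero_of_mem_kStarComponent (p : ℕ) (hp : p.Prime) (hp2 : 2 < p) [CharP F p] (k : ℕ)
    {n : ℤ} (hn : 0 < n) {x : ExteriorAlgebra F L} (hx : x ∈ kStarComponent e k n) :
    x ^ p = 0 := by
  have h2 : (2 : F) ≠ 0 := two_ne_zero_of_two_lt_charP p hp2
  have : Fact p.Prime := ⟨hp⟩
  have : CharP (ExteriorAlgebra F L) p := by
    have := (ExteriorAlgebra.algebraMap_leftInverse (R := F) L).injective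
    exact charP_of_injective_algebraMap this p
  have hsq : ∀ y : ExteriorAlgebra F L, y * y = 0 → y ^ p = 0 := fun y hy => by
    rw [← Nat.sub_add_cancel hp2.le, pow_add, pow_two, hy, mul_zero]
  have key : ∃ z w : ExteriorAlgebra F L, (∀ y, Commute z y) ∧ z ^ p = 0 ∧ w ∈ oddSpan e ∧
      x = z + w := by
    rw [kStarComponent, grassmannComponent] at hx
    induction hx using Submodule.span_induction with
    | mem x h =>
      obtain ⟨l, hl, rfl⟩ := h
      change ∃ z w, _ ∧ _ ∧ _ ∧ wedge e l = z + w
      rcases Nat.even_or_odd l.length with h | h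
      · refine ⟨wedge e l, 0, wedge_commute_of_even e h, hsq _ ?_, Submodule.zero_mem _,
          (add_zero _).symm⟩
        rw [← wedge_append]
        apply wedge_of_not_nodup
        -- `l` is not empty since its degree is positive
        cases l with
        | nil => simp at hl; omega
        | cons i l => simp
      · exact ⟨0, wedge e l, Commute.zero_left, zero_pow hp.ne_zero, wedge_mem_oddSpan e h,
          (zero_add _).symm⟩
    | zero => exact ⟨0, 0, Commute.zero_left, zero_pow hp.ne_zero, Submodule.zero_mem _,
        (add_zero _).symm⟩
    | add x y _ _ hx hy =>
      obtain ⟨z, w, hz, hzp, hw, rfl⟩ := hx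
      obtain ⟨z', w', hz', hzp', hw', rfl⟩ := hy
      refine ⟨z + z', w + w', fun y => (hz y).add_left (hz' y), ?_, Submodule.add_mem _ hw hw',
        by abel⟩
      rw [add_pow_char_of_commute _ (hz z'), hzp, hzp', add_zero]
    | smul c x _ hx =>
      obtain ⟨z, w, hz, hzp, hw, rfl⟩ := hx
      exact ⟨c • z, c • w, fun y => (hz y).smul_left c, by rw [smul_pow, hzp, smul_zero],
        Submodule.smul_mem _ c hw, smul_add _ _ _⟩
  obtain ⟨z, w, hz, hzp, hw, rfl⟩ := key
  rw [add_pow_char_of_commute _ (hz w), hzp, hsq w (oddSpan_mul_self e h2 hw), add_zero]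

end Grassmann

/-! ### `T_ℤ`-ideals -/

/-- A two-sided ideal contains all triple commutators if it contains those of a spanning set. -/
theorem lie_lie_mem_of_span_eq_top {F R : Type*} [CommRing F] [Ring R] [Algebra F R]
    (I : TwoSidedIdeal R) {H : Set R} (hH : Submodule.span F H = ⊤)
    (h : ∀ f ∈ H, ∀ g ∈ H, ∀ q ∈ H, ⁅⁅f, g⁆, q⁆ ∈ I) (f g q : R) : ⁅⁅f, g⁆, q⁆ ∈ I := by
  have hsmul : ∀ (c : F) {f : R}, f ∈ I → c • f ∈ I := fun c f hf => by
    rw [Algebra.smul_def]; exact I.mul_mem_left _ _ hf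
  have mem : ∀ f : R, f ∈ Submodule.span F H := fun f => by rw [hH]; trivial
  induction mem f using Submodule.span_induction with
  | zero => simp [Ring.lie_def]
  | add f₁ f₂ _ _ h₁ h₂ =>
    have key : ⁅⁅f₁ + f₂, g⁆, q⁆ = ⁅⁅f₁, g⁆, q⁆ + ⁅⁅f₂, g⁆, q⁆ := by
      simp only [Ring.lie_def]; noncomm_ring
    rw [key]; exact I.add_mem h₁ h₂
  | smul c f _ h =>
    have key : ⁅⁅c • f, g⁆, q⁆ = c • ⁅⁅f, g⁆, q⁆ := by
      simp only [Ring.lie_def, smul_mul_assoc, mul_smul_comm, smul_sub, sub_mul, mul_sub]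
    rw [key]; exact hsmul c h
  | mem f hf =>
    induction mem g using Submodule.span_induction with
    | zero => simp [Ring.lie_def]
    | add g₁ g₂ _ _ h₁ h₂ =>
      have key : ⁅⁅f, g₁ + g₂⁆, q⁆ = ⁅⁅f, g₁⁆, q⁆ + ⁅⁅f, g₂⁆, q⁆ := by
        simp only [Ring.lie_def]; noncomm_ring
      rw [key]; exact I.add_mem h₁ h₂
    | smul c g _ h =>
      have key : ⁅⁅f, c • g⁆, q⁆ = c • ⁅⁅f, g⁆, q⁆ := by
        simp only [Ring.lie_def, smul_mul_assoc, mul_smul_comm, smul_sub, sub_mul, mul_sub]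
      rw [key]; exact hsmul c h
    | mem g hg =>
      induction mem q using Submodule.span_induction with
      | zero => simp [Ring.lie_def]
      | add q₁ q₂ _ _ h₁ h₂ =>
        have key : ⁅⁅f, g⁆, q₁ + q₂⁆ = ⁅⁅f, g⁆, q₁⁆ + ⁅⁅f, g⁆, q₂⁆ := by
          simp only [Ring.lie_def]; noncomm_ring
        rw [key]; exact I.add_mem h₁ h₂
      | smul c q _ h =>
        have key : ⁅⁅f, g⁆, c • q⁆ = c • ⁅⁅f, g⁆, q⁆ := by
          simp only [Ring.lie_def, smul_mul_assoc, mul_smul_comm, smul_sub, sub_mul, mul_sub]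
        rw [key]; exact hsmul c h
      | mem q hq => exact h f hf g hg q hq

section TZIdeals

variable {F : Type*} [Field F]

theorem gvar_mem_freeComponent (i : ℤ) (j : ℕ) : gvar F i j ∈ freeComponent F i :=
  Submodule.subset_span ⟨[(i, j)], by simp⟩

theorem one_mem_freeComponent : (1 : FreeZAlgebra F) ∈ freeComponent F 0 :=
  Submodule.subset_span ⟨[], by simp⟩

theorem mul_mem_freeComponent {m n : ℤ} {f g : FreeZAlgebra F} (hf : f ∈ freeComponent F m)
    (hg : g ∈ freeComponent F n) : f * g ∈ freeComponent F (m + n) := by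
  have := Submodule.mul_mem_mul hf hg
  simp only [freeComponent, Submodule.span_mul_span] at this ⊢
  refine Submodule.span_mono ?_ this
  rintro _ ⟨_, ⟨l₁, rfl, rfl⟩, _, ⟨l₂, rfl, rfl⟩, rfl⟩
  exact ⟨l₁ ++ l₂, by simp, by simp⟩

/-- A substitution of elements of the right degrees maps the components of the free algebra
to the components of any grading. -/
theorem lift_mem_of_mem_freeComponent {R : Type*} [Ring R] [Algebra F R] (A : ℤ → Submodule F R)
    (h1 : (1 : R) ∈ A 0) (hmul : ∀ {m n : ℤ} {x y : R}, x ∈ A m → y ∈ A n → x * y ∈ A (m + n))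
    {a : ℤ × ℕ → R} (ha : ∀ v, a v ∈ A v.1) {n : ℤ} {f : FreeZAlgebra F}
    (hf : f ∈ freeComponent F n) : FreeAlgebra.lift F a f ∈ A n := by
  induction hf using Submodule.span_induction with
  | mem _ h =>
    obtain ⟨l, rfl, rfl⟩ := h
    induction l with
    | nil => simpa using h1
    | cons v l ih =>
      simpa [gvar] using hmul (ha v) ih
  | zero => simp
  | add _ _ _ _ h₁ h₂ => rw [map_add]; exact Submodule.add_mem _ h₁ h₂
  | smul c _ _ h => rw [map_smul]; exact Submodule.smul_mem _ c h

/-- Substituting homogeneous polynomials of the right degrees for the variables is a graded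
endomorphism. -/
theorem isGradedEndomorphism_lift {a : ℤ × ℕ → FreeZAlgebra F}
    (ha : ∀ v, a v ∈ freeComponent F v.1) : IsGradedEndomorphism (FreeAlgebra.lift F a) :=
  fun _ _ hf => lift_mem_of_mem_freeComponent (freeComponent F) one_mem_freeComponent
    mul_mem_freeComponent ha hf

theorem isTZIdeal_gradedIdentities {R : Type*} [Ring R] [Algebra F R] (A : ℤ → Submodule F R)
    (h1 : (1 : R) ∈ A 0)
    (hmul : ∀ {m n : ℤ} {x y : R}, x ∈ A m → y ∈ A n → x * y ∈ A (m + n)) :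
    IsTZIdeal (gradedIdentities A) := by
  intro φ hφ f hf
  rw [mem_gradedIdentities] at hf ⊢
  intro a ha
  have hcomp : (FreeAlgebra.lift F a).comp φ
      = FreeAlgebra.lift F fun v => FreeAlgebra.lift F a (φ (gvar F v.1 v.2)) := by
    ext v
    simp [gvar]
  rw [← AlgHom.comp_apply, hcomp]
  exact hf _ fun v => lift_mem_of_mem_freeComponent A h1 hmul ha
    (hφ _ _ (gvar_mem_freeComponent v.1 v.2))

theorem isTZIdeal_tzIdealSpan (S : Set (FreeZAlgebra F)) : IsTZIdeal (tzIdealSpan S) := by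
  intro φ hφ f hf
  simp only [tzIdealSpan, TwoSidedIdeal.mem_sInf] at hf ⊢
  exact fun I hI => hI.1 φ hφ f (hf I hI)

theorem subset_tzIdealSpan (S : Set (FreeZAlgebra F)) :
    S ⊆ (tzIdealSpan S : Set (FreeZAlgebra F)) := by
  intro f hf
  simp only [tzIdealSpan, SetLike.mem_coe, TwoSidedIdeal.mem_sInf]
  exact fun I hI => hI.2 hf

theorem tzIdealSpan_le {S : Set (FreeZAlgebra F)} {I : TwoSidedIdeal (FreeZAlgebra F)}
    (hI : IsTZIdeal I) (hS : S ⊆ (I : Set (FreeZAlgebra F))) : tzIdealSpan S ≤ I :=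
  sInf_le ⟨hI, hS⟩

theorem span_words : Submodule.span F
    (Set.range fun l : List (ℤ × ℕ) => (l.map fun v => gvar F v.1 v.2).prod) = ⊤ := by
  rw [eq_top_iff]
  rintro f -
  induction f using FreeAlgebra.induction with
  | grade0 r =>
    rw [Algebra.algebraMap_eq_smul_one]
    exact Submodule.smul_mem _ _ (Submodule.subset_span ⟨[], rfl⟩)
  | grade1 v => exact Submodule.subset_span ⟨[v], by simp [gvar]⟩
  | mul a b ha hb =>
    have := Submodule.mul_mem_mul ha hb
    rw [Submodule.span_mul_span] at this
    refine Submodule.span_mono ?_ this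
    rintro _ ⟨_, ⟨l₁, rfl⟩, _, ⟨l₂, rfl⟩, rfl⟩
    exact ⟨l₁ ++ l₂, by simp⟩
  | add a b ha hb => exact Submodule.add_mem _ ha hb

variable {I : TwoSidedIdeal (FreeZAlgebra F)} (hI : IsTZIdeal I)
include hI

theorem IsTZIdeal.mem_of_gvar_mem {n : ℤ} (h : gvar F n 0 ∈ I) {f : FreeZAlgebra F}
    (hf : f ∈ freeComponent F n) : f ∈ I := by
  classical
  have := hI _ (isGradedEndomorphism_lift
    (a := fun v => if v = (n, 0) then f else gvar F v.1 v.2) fun v => by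
      split_ifs with hv
      · rw [hv]; exact hf
      · exact gvar_mem_freeComponent _ _) _ h
  simpa [gvar] using this

/-- A `T_ℤ`-ideal that contains the triple commutators of the variables contains those of all
polynomials. The homogeneous case is a substitution, and the general case follows by linearity. -/
theorem IsTZIdeal.lie_lie_mem (h : tripleCommutators F ⊆ (I : Set (FreeZAlgebra F)))
    (f g q : FreeZAlgebra F) : ⁅⁅f, g⁆, q⁆ ∈ I := by
  have hom : ∀ {i₁ i₂ i₃ : ℤ} {f g q : FreeZAlgebra F}, f ∈ freeComponent F i₁ →
      g ∈ freeComponent F i₂ → q ∈ freeComponent F i₃ → ⁅⁅f, g⁆, q⁆ ∈ I := by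
    intro i₁ i₂ i₃ f g q hf hg hq
    have := hI _ (isGradedEndomorphism_lift (a := fun v =>
      if v = (i₁, 1) then f else if v = (i₂, 2) then g else if v = (i₃, 3) then q
        else gvar F v.1 v.2) fun v => by
      split_ifs with h₁ h₂ h₃
      · rw [h₁]; exact hf
      · rw [h₂]; exact hg
      · rw [h₃]; exact hq
      · exact gvar_mem_freeComponent _ _) _ (h ⟨i₁, i₂, i₃, rfl⟩)
    simpa [gvar, Ring.lie_def] using this
  refine lie_lie_mem_of_span_eq_top (F := F) I span_words ?_ f g q
  rintro _ ⟨l₁, rfl⟩ _ ⟨l₂, rfl⟩ _ ⟨l₃, rfl⟩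
  exact hom (Submodule.subset_span ⟨l₁, rfl, rfl⟩) (Submodule.subset_span ⟨l₂, rfl, rfl⟩)
    (Submodule.subset_span ⟨l₃, rfl, rfl⟩)

end TZIdeals

/-! ### Normal words -/

section NormalWords

/-- The product, in some order, of the values `x v` over a multiset `s.1`, times the product of
the commutators of consecutive values in some ordering of a finite set `s.2`. -/
noncomputable def normalWord {σ R : Type*} [Ring R] (x : σ → R) (s : Multiset σ × Finset σ) : R :=
  (s.1.toList.map x).prod * commProd (s.2.toList.map x)

theorem map_normalWord {σ R S : Type*} [Ring R] [Ring S] (f : R →+* S) (x : σ → R)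
    (s : Multiset σ × Finset σ) : f (normalWord x s) = normalWord (f ∘ x) s := by
  simp [normalWord, map_list_prod, map_commProd]

theorem commProd_map_smul {σ F R : Type*} [CommRing F] [Ring R] [Algebra F R] (c : σ → F)
    (x : σ → R) : ∀ l : List σ,
      commProd (l.map fun v => c v • x v) = (l.map c).prod • commProd (l.map x)
  | [] => by simp [commProd]
  | [_] => by simp [commProd]
  | v :: w :: l => by
    have : ⁅c v • x v, c w • x w⁆ = (c v * c w) • ⁅x v, x w⁆ := by
      simp only [Ring.lie_def, smul_sub, smul_mul_smul_comm, mul_comm]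
    simp only [List.map_cons, commProd, this, commProd_map_smul c x l, List.prod_cons,
      smul_mul_smul_comm, mul_assoc]

theorem list_prod_map_smul {σ F R : Type*} [CommRing F] [Ring R] [Algebra F R] (c : σ → F)
    (x : σ → R) (l : List σ) :
    (l.map fun v => c v • x v).prod = (l.map c).prod • (l.map x).prod := by
  induction l with
  | nil => simp
  | cons v l ih => simp only [List.map_cons, List.prod_cons, ih, smul_mul_smul_comm]

/-- Normal words are multihomogeneous. -/
theorem normalWord_smul {σ F R : Type*} [CommRing F] [Ring R] [Algebra F R] (c : σ → F)
    (x : σ → R) (s : Multiset σ × Finset σ) :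
    normalWord (fun v => c v • x v) s = ((s.1 + s.2.val).map c).prod • normalWord x s := by
  rw [normalWord, normalWord, list_prod_map_smul, commProd_map_smul, smul_mul_smul_comm,
    Multiset.prod_map_toList, Finset.prod_map_toList, Multiset.map_add, Multiset.prod_add]
  rfl

/-- The conditions on the normal words that form a basis of the free graded algebra modulo the
graded identities of `E^{k*}`: an even number of variables in the commutators, no negative degrees,
total degree at most `k`, and less than `p` occurrences outside of the commutators for the
variables of positive degree. -/
structure IsAdmissible (p k : ℕ) (s : Multiset (ℤ × ℕ) × Finset (ℤ × ℕ)) : Prop where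
  even_card : Even s.2.card
  nonneg : ∀ v ∈ s.1 + s.2.val, 0 ≤ v.1
  sum_le : ((s.1 + s.2.val).map Prod.fst).sum ≤ k
  count_lt : ∀ v ∈ s.1, 0 < v.1 → s.1.count v < p

end NormalWords

/-! ### Graded identities of the Grassmann algebra -/

section Soundness

variable {F L : Type*} [Field F] [AddCommGroup L] [Module F L] (e : Module.Basis ℕ F L)

theorem tzIdealSpan_le_gradedIdentities (p : ℕ) (hp : p.Prime) (hp2 : 2 < p) [CharP F p] (k : ℕ) :
    tzIdealSpan (outerVariables F k ∪ tripleCommutators F ∪ powerIdentities F p k)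
      ≤ gradedIdentities (kStarComponent e k) := by
  refine tzIdealSpan_le (isTZIdeal_gradedIdentities _ (one_mem_kStarComponent e k)
    (mul_mem_kStarComponent e k)) ?_
  rintro f ((⟨i, j, hi, rfl⟩ | ⟨i₁, i₂, i₃, rfl⟩) | ⟨t, j, ht, -, rfl⟩) <;>
    rw [SetLike.mem_coe, mem_gradedIdentities] <;> intro a ha
  · have := ha (i, j)
    rw [kStarComponent_eq_bot e k hi] at this
    simpa [gvar] using this
  · have := lie_lie_eq_zero e (a (i₁, 1)) (a (i₂, 2)) (a (i₃, 3))
    simpa [gvar, Ring.lie_def] using this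
  · have hpos : (0 : ℤ) < t := by have := (Finset.mem_Icc.1 ht).1; omega
    simpa [gvar] using pow_eq_zero_of_mem_kStarComponent e p hp hp2 k hpos (ha (t, j))

end Soundness

/-! ### Normal words span modulo the generated ideal -/

section Spanning

variable {F : Type*} [Field F]

theorem list_prod_ι_mem_freeComponent (l : List (ℤ × ℕ)) :
    (l.map (FreeAlgebra.ι F)).prod ∈ freeComponent F (l.map Prod.fst).sum :=
  Submodule.subset_span ⟨l, rfl, rfl⟩

theorem commProd_ι_mem_freeComponent : ∀ l : List (ℤ × ℕ),
    commProd (l.map (FreeAlgebra.ι F)) ∈ freeComponent F (l.map Prod.fst).sum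
  | [] => by simpa [commProd] using one_mem_freeComponent
  | [_] => Submodule.zero_mem _
  | v :: w :: l => by
    have hv := gvar_mem_freeComponent (F := F) v.1 v.2
    have hw := gvar_mem_freeComponent (F := F) w.1 w.2
    have : ⁅gvar F v.1 v.2, gvar F w.1 w.2⁆ ∈ freeComponent F (v.1 + w.1) :=
      Submodule.sub_mem _ (mul_mem_freeComponent hv hw)
        (by rw [add_comm]; exact mul_mem_freeComponent hw hv)
    have := mul_mem_freeComponent this (commProd_ι_mem_freeComponent l)
    simp only [List.map_cons, commProd, List.sum_cons, ← add_assoc]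
    exact this

theorem normalWord_ι_mem_freeComponent (s : Multiset (ℤ × ℕ) × Finset (ℤ × ℕ)) :
    normalWord (FreeAlgebra.ι F) s ∈ freeComponent F ((s.1 + s.2.val).map Prod.fst).sum := by
  have := mul_mem_freeComponent (list_prod_ι_mem_freeComponent (F := F) s.1.toList)
    (commProd_ι_mem_freeComponent s.2.toList)
  rw [Multiset.sum_map_toList, Finset.sum_map_toList] at this
  rw [Multiset.map_add, Multiset.sum_add]
  exact this

/-- Modulo a `T_ℤ`-ideal that contains the generating identities, each polynomial is a linear
combination of admissible normal words. -/
theorem exists_sub_linearCombination_mem {p : ℕ} (hp : 0 < p) (k : ℕ)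
    {I : TwoSidedIdeal (FreeZAlgebra F)} (hI : IsTZIdeal I)
    (ho : outerVariables F k ⊆ (I : Set (FreeZAlgebra F)))
    (ht : tripleCommutators F ⊆ (I : Set (FreeZAlgebra F)))
    (hpow : powerIdentities F p k ⊆ (I : Set (FreeZAlgebra F))) (f : FreeZAlgebra F) :
    ∃ c : Multiset (ℤ × ℕ) × Finset (ℤ × ℕ) →₀ F, (∀ s ∈ c.support, IsAdmissible p k s) ∧
      f - Finsupp.linearCombination F (normalWord (FreeAlgebra.ι F)) c ∈ I := by
  classical
  let π : FreeZAlgebra F →ₐ[F] I.ringCon.Quotient := I.ringCon.mkₐ (α := F)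
  have hπ : ∀ g, π g = 0 ↔ g ∈ I := fun g => by
    rw [TwoSidedIdeal.mem_iff, ← RingCon.eq]; rfl
  have hsurj : Function.Surjective π := RingCon.mkₐ_surjective _
  have hQ : ∀ a b c : I.ringCon.Quotient, ⁅⁅a, b⁆, c⁆ = 0 := by
    intro a b c
    obtain ⟨a, rfl⟩ := hsurj a
    obtain ⟨b, rfl⟩ := hsurj b
    obtain ⟨c, rfl⟩ := hsurj c
    have := (hπ _).2 (hI.lie_lie_mem ht a b c)
    simpa [Ring.lie_def] using this
  have hneg : ∀ v : ℤ × ℕ, v.1 < 0 → π (FreeAlgebra.ι F v) = 0 := fun v hv =>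
    (hπ _).2 (ho ⟨v.1, v.2, fun h => absurd h.1 (by omega), rfl⟩)
  have hdeg : ∀ n : ℤ, (k : ℤ) < n → ∀ g ∈ freeComponent F n, π g = 0 := fun n hn g hg =>
    (hπ _).2 (hI.mem_of_gvar_mem (ho ⟨n, 0, fun h => absurd h.2 (by omega), rfl⟩) hg)
  have hpw : ∀ v : ℤ × ℕ, 0 < v.1 → π (FreeAlgebra.ι F v) ^ p = 0 := by
    rintro ⟨i, j⟩ hv
    obtain ⟨t, rfl⟩ := Int.eq_ofNat_of_zero_le hv.le
    simp only at hv
    rw [← map_pow]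
    rcases le_or_gt (p * t) k with hle | hgt
    · refine (hπ _).2 (hpow ⟨t, j, Finset.mem_Icc.2 ⟨by omega, ?_⟩, hle, rfl⟩)
      exact (Nat.le_mul_of_pos_left t hp).trans hle
    · refine hdeg (p * t : ℤ) (by exact_mod_cast hgt) _ ?_
      have := list_prod_ι_mem_freeComponent (F := F) (List.replicate p ((t : ℤ), j))
      simpa using this
  let x : ℤ × ℕ → I.ringCon.Quotient := π ∘ FreeAlgebra.ι F
  have hx : ∀ s, π (normalWord (FreeAlgebra.ι F) s) = normalWord x s :=
    fun s => map_normalWord π.toRingHom _ s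
  let V := Submodule.span F (normalWord x '' {s | IsAdmissible p k s})
  have hV : ∀ (a : Multiset (ℤ × ℕ)) (J : Finset (ℤ × ℕ)), ∃ l : List (ℤ × ℕ),
      (l : Multiset (ℤ × ℕ)) = a ∧ (l.map x).prod * commProd (J.toList.map x) ∈ V := by
    intro a J
    by_cases had : IsAdmissible p k (a, J)
    · exact ⟨a.toList, a.coe_toList, Submodule.subset_span ⟨_, had, rfl⟩⟩
    by_cases h1 : Even J.card
    swap
    · refine ⟨a.toList, a.coe_toList, ?_⟩
      rw [commProd_of_odd _ (by simpa using h1), mul_zero]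
      exact V.zero_mem
    by_cases h2 : ∀ v ∈ a + J.val, 0 ≤ v.1
    swap
    · refine ⟨a.toList, a.coe_toList, ?_⟩
      push Not at h2
      obtain ⟨v, hv, hlt⟩ := h2
      have h0 : x v = 0 := hneg v hlt
      rcases Multiset.mem_add.1 hv with hva | hvJ
      · rw [List.prod_eq_zero (List.mem_map.2 ⟨v, by simpa using hva, h0⟩), zero_mul]
        exact V.zero_mem
      · rw [commProd_of_mem_center hQ (List.mem_map.2 ⟨v, by simpa using hvJ, h0⟩)
          Commute.zero_left, mul_zero]
        exact V.zero_mem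
    by_cases h3 : ((a + J.val).map Prod.fst).sum ≤ (k : ℤ)
    swap
    · refine ⟨a.toList, a.coe_toList, ?_⟩
      have := hdeg _ (not_le.1 h3) _ (normalWord_ι_mem_freeComponent (a, J))
      have h0 : normalWord x (a, J) = 0 := (hx _).symm.trans this
      rw [normalWord] at h0
      rw [h0]
      exact V.zero_mem
    obtain ⟨v, hva, hpos, hcount⟩ : ∃ v ∈ a, 0 < v.1 ∧ p ≤ a.count v := by
      by_contra hcon
      push Not at hcon
      exact had ⟨h1, h2, h3, hcon⟩
    -- collect `p` occurrences of the variable at the front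
    obtain ⟨b, rfl⟩ := Multiset.le_iff_exists_add.1 (Multiset.le_count_iff_replicate_le.1 hcount)
    refine ⟨List.replicate p v ++ b.toList, ?_, ?_⟩
    · rw [← Multiset.coe_add, b.coe_toList, Multiset.coe_replicate]
    · have h0 : x v ^ p = 0 := hpw v hpos
      rw [List.map_append, List.prod_append, List.map_replicate, List.prod_replicate, h0, zero_mul,
        zero_mul]
      exact V.zero_mem
  have hmem : π f ∈ V := by
    have hf : f ∈ Submodule.span F
        (Set.range fun l : List (ℤ × ℕ) => (l.map fun v => gvar F v.1 v.2).prod) := by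
      rw [span_words]; trivial
    induction hf using Submodule.span_induction with
    | mem _ h =>
      obtain ⟨l, rfl⟩ := h
      have := word_mem_of_forall_exists hQ V x hV l []
      simpa [commProd, map_list_prod, gvar, Function.comp_def, x] using this
    | zero => rw [map_zero]; exact V.zero_mem
    | add _ _ _ _ h₁ h₂ => rw [map_add]; exact V.add_mem h₁ h₂
    | smul c _ _ h => rw [map_smul]; exact V.smul_mem c h
  obtain ⟨c, hc, hcf⟩ := (Finsupp.mem_span_image_iff_linearCombination F).1 hmem
  refine ⟨c, fun s hs => hc hs, (hπ _).1 ?_⟩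
  rw [map_sub, sub_eq_zero, ← hcf]
  simp only [Finsupp.linearCombination_apply, Finsupp.sum, map_sum, map_smul]
  refine Finset.sum_congr rfl fun s _ => ?_
  congr 1
  exact (hx s).symm

end Spanning

/-! ### Disjoint products of basis vectors -/

section Allocation

/-- Disjoint finite sets of indices with prescribed parities of their sizes and prescribed numbers
of elements below `k` exist if the latter numbers add up to at most `k`. -/
theorem exists_disjoint_finsets {τ : Type*} [DecidableEq τ] (k : ℕ) (w : τ → ℕ) (P : τ → Prop)
    (T : Finset τ) (hT : ∑ s ∈ T, w s ≤ k) :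
    ∃ B : τ → Finset ℕ, (∀ s, Odd (B s).card ↔ P s) ∧
      (∀ s ∈ T, ((B s).filter (· < k)).card = w s) ∧
      ∀ s ∈ T, ∀ t ∈ T, s ≠ t → Disjoint (B s) (B t) := by
  classical
  induction T using Finset.induction_on with
  | empty => exact ⟨fun s => if P s then {0} else ∅, fun s => by by_cases h : P s <;> simp [h],
      by simp, by simp⟩
  | insert s T hs ih =>
    rw [Finset.sum_insert hs] at hT
    obtain ⟨B, hP, hw, hd⟩ := ih (by omega)
    let U := T.biUnion B
    have hU : (U.filter (· < k)).card = ∑ t ∈ T, w t := by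
      rw [Finset.filter_biUnion, Finset.card_biUnion]
      · exact Finset.sum_congr rfl hw
      · exact fun t ht u hu htu => (hd t ht u hu htu).mono (Finset.filter_subset _ _)
          (Finset.filter_subset _ _)
    have hcard : w s ≤ (Finset.range k \ U.filter (· < k)).card := by
      have := Finset.le_card_sdiff (U.filter (· < k)) (Finset.range k)
      rw [hU, Finset.card_range] at this
      omega
    obtain ⟨C, hC, hCw⟩ := Finset.exists_subset_card_eq hcard
    have hCk : ∀ i ∈ C, i < k ∧ i ∉ U := fun i hi => by
      have := hC hi
      simp only [Finset.mem_sdiff, Finset.mem_range, Finset.mem_filter, not_and] at this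
      exact ⟨this.1, fun h => this.2 h this.1⟩
    obtain ⟨x, hx⟩ := Infinite.exists_notMem_finset (U ∪ Finset.range k)
    simp only [Finset.mem_union, Finset.mem_range, not_or] at hx
    have hxC : x ∉ C := fun h => hx.2 (hCk x h).1
    -- an index `x ≥ k` corrects the parity if necessary
    obtain ⟨D, hDP, hDw, hDU⟩ : ∃ D : Finset ℕ, (Odd D.card ↔ P s) ∧
        (D.filter (· < k)).card = w s ∧ Disjoint D U := by
      have hCf : C.filter (· < k) = C := Finset.filter_true_of_mem fun i hi => (hCk i hi).1
      have hCU : Disjoint C U := Finset.disjoint_left.2 fun i hi => (hCk i hi).2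
      by_cases h : Odd C.card ↔ P s
      · exact ⟨C, h, by rw [hCf, hCw], hCU⟩
      · refine ⟨insert x C, ?_, ?_, Finset.disjoint_insert_left.2 ⟨hx.1, hCU⟩⟩
        · rw [Finset.card_insert_of_notMem hxC]
          grind
        · rw [Finset.filter_insert, if_neg hx.2, hCf, hCw]
    have hDB : ∀ t ∈ T, Disjoint D (B t) := fun t ht =>
      hDU.mono_right (Finset.subset_biUnion_of_mem B ht)
    have hne : ∀ t ∈ T, t ≠ s := fun t ht h => hs (h ▸ ht)
    refine ⟨Function.update B s D, fun t => ?_, fun t ht => ?_, fun t ht u hu htu => ?_⟩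
    · by_cases h : t = s
      · subst h; simpa using hDP
      · simpa [h] using hP t
    · rcases Finset.mem_insert.1 ht with rfl | ht
      · simpa using hDw
      · simpa [hne t ht] using hw t ht
    · rcases Finset.mem_insert.1 ht with ht | ht <;> rcases Finset.mem_insert.1 hu with hu | hu
      · exact absurd (ht.trans hu.symm) htu
      · simpa [ht, hne u hu] using hDB u hu
      · simpa [hu, hne t ht] using (hDB t ht).symm
      · simpa [hne t ht, hne u hu] using hd t ht u hu htu

end Allocation

section SquareZero

theorem add_pow_of_sq_zero {Z : Type*} [CommRing Z] (x : Z) {y : Z} (hy : y * y = 0) (n : ℕ) :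
    (x + y) ^ (n + 1) = x ^ (n + 1) + (n + 1) * x ^ n * y := by
  induction n with
  | zero => simp
  | succ n ih =>
    rw [pow_succ, ih]
    push_cast
    linear_combination (n + 1) * x ^ n * hy

theorem sum_range_pow_of_sq_zero {Z : Type*} [CommRing Z] {m : ℕ → Z} (hm : ∀ i, m i * m i = 0)
    (n : ℕ) : (∑ i ∈ Finset.range n, m i) ^ n = n.factorial * ∏ i ∈ Finset.range n, m i := by
  have top : ∀ n, (∑ i ∈ Finset.range n, m i) ^ (n + 1) = 0 := by
    intro n
    induction n with
    | zero => simp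
    | succ n ih =>
      rw [Finset.sum_range_succ, add_pow_of_sq_zero _ (hm n), pow_succ, ih]
      simp
  induction n with
  | zero => simp
  | succ n ih =>
    rw [Finset.sum_range_succ, add_pow_of_sq_zero _ (hm n), top, ih, Finset.prod_range_succ,
      Nat.factorial_succ]
    push_cast
    ring

/-- A monomial in sums of as many elements of square zero as it has factors: the product of all
these elements, up to factorials. -/
theorem prod_map_sum_range_of_sq_zero {σ Z : Type*} [DecidableEq σ] [CommRing Z]
    {m : σ × ℕ → Z} (hm : ∀ s, m s * m s = 0) (b : Multiset σ) :
    (b.map fun v => ∑ i ∈ Finset.range (b.count v), m (v, i)).prod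
      = (∏ v ∈ b.toFinset, ((b.count v).factorial : Z)) * ∏ s ∈ b.toEnumFinset, m s := by
  rw [Finset.prod_multiset_map_count, Finset.prod_finset_product b.toEnumFinset b.toFinset
    (fun v => Finset.range (b.count v)), ← Finset.prod_mul_distrib]
  · exact Finset.prod_congr rfl fun v _ => sum_range_pow_of_sq_zero (fun i => hm (v, i)) _
  · intro s
    simp only [Multiset.mem_toEnumFinset, Multiset.mem_toFinset, Finset.mem_range]
    exact ⟨fun h => ⟨Multiset.count_pos.1 (by omega), h⟩, fun h => h.2⟩

end SquareZero

/-! ### Independence of the admissible normal words -/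

section Independence

variable {F L : Type*} [Field F] [AddCommGroup L] [Module F L] (e : Module.Basis ℕ F L)

theorem commProd_map_central_add_odd {σ : Type*} {z w : σ → ExteriorAlgebra F L}
    (hz : ∀ v y, Commute (z v) y) (hw : ∀ v, w v ∈ oddSpan e) : ∀ l : List σ, Even l.length →
      commProd (l.map fun v => z v + w v) = (2 : F) ^ (l.length / 2) • (l.map w).prod
  | [], _ => by simp [commProd]
  | [_], h => by simp at h
  | u :: v :: l, h => by
    have h' : Even l.length := by
      simp only [List.length_cons] at h
      grind
    have hlen : (u :: v :: l).length / 2 = l.length / 2 + 1 := by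
      simp only [List.length_cons]; omega
    rw [hlen]
    simp only [List.map_cons, commProd, commProd_map_central_add_odd hz hw l h', List.prod_cons,
      lie_central_add_odd e (hz u) (hw u) (hz v) (hw v)]
    rw [smul_mul_smul_comm, pow_succ', mul_assoc]

theorem list_prod_map_add_mul {σ R : Type*} [Ring R] {z w : σ → R} {M : R}
    (h : ∀ v, w v * M = 0) (hz : ∀ v y, Commute (z v) y) (l : List σ) :
    (l.map fun v => z v + w v).prod * M = (l.map z).prod * M := by
  induction l with
  | nil => rfl
  | cons v l ih =>
    have hc : Commute (l.map z).prod (w v) :=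
      Commute.list_prod_left _ _ (by simpa using fun u _ => hz u (w v))
    rw [List.map_cons, List.prod_cons, List.map_cons, List.prod_cons, mul_assoc, ih, add_mul,
      ← mul_assoc (w v), ← hc.eq, mul_assoc _ (w v), h, mul_zero, add_zero, mul_assoc]

theorem wedge_toList_mem_kStarComponent (k : ℕ) (B : Finset ℕ) :
    wedge e B.toList ∈ kStarComponent e k (B.filter (· < k)).card := by
  apply wedge_mem_kStarComponent
  rw [Finset.sum_map_toList]
  simp

/-- An admissible normal word has a nonzero value under a graded substitution in which only the
variables of its commutator part have non-central values. -/
theorem exists_normalWord_ne_zero (p : ℕ) (hp : p.Prime) (hp2 : 2 < p) [CharP F p] (k : ℕ)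
    {s : Multiset (ℤ × ℕ) × Finset (ℤ × ℕ)} (hs : IsAdmissible p k s) :
    ∃ y : ℤ × ℕ → ExteriorAlgebra F L, (∀ v, y v ∈ kStarComponent e k v.1) ∧
      (∀ v ∉ s.2, ∀ r, Commute (y v) r) ∧ normalWord y s ≠ 0 := by
  classical
  obtain ⟨a, J⟩ := s
  have hnn : ∀ v, v ∈ a ∨ v ∈ J → 0 ≤ v.1 := fun v hv =>
    hs.nonneg v (Multiset.mem_add.2 (hv.imp id fun h => h))
  -- the variables of degree `0` in `a` will take the value `1`, those in `b` sums of nilpotents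
  let b := a.filter fun v => v.1 ≠ 0
  have hba : ∀ v ∈ b, v ∈ a := fun v hv => Multiset.mem_of_mem_filter hv
  -- one slot for each factor
  let w : (ℤ × ℕ) × ℕ ⊕ (ℤ × ℕ) → ℕ := Sum.elim (fun s => s.1.1.toNat) fun v => v.1.toNat
  let P : (ℤ × ℕ) × ℕ ⊕ (ℤ × ℕ) → Prop := Sum.elim (fun _ => False) fun _ => True
  let T := b.toEnumFinset.disjSum J
  have hT : ∑ s ∈ T, w s ≤ k := by
    have hb : ∑ s ∈ b.toEnumFinset, s.1.1.toNat = (b.map fun v => v.1.toNat).sum := by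
      conv_rhs => rw [← Multiset.map_toEnumFinset_fst b, Multiset.map_map]
      rfl
    have hba' : (b.map fun v => v.1.toNat).sum ≤ (a.map fun v => v.1.toNat).sum := by
      conv_rhs => rw [← Multiset.filter_add_not (fun v : ℤ × ℕ => v.1 ≠ 0) a, Multiset.map_add,
        Multiset.sum_add]
      exact Nat.le_add_right _ _
    have hcast : ((((a + J.val).map fun v => v.1.toNat).sum : ℕ) : ℤ)
        = ((a + J.val).map Prod.fst).sum := by
      rw [← Nat.coe_castAddMonoidHom, AddMonoidHom.map_multiset_sum, Multiset.map_map]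
      congr 1
      refine Multiset.map_congr rfl fun v hv => ?_
      simpa using hs.nonneg v hv
    have hle := hs.sum_le
    rw [← hcast, Nat.cast_le, Multiset.map_add, Multiset.sum_add] at hle
    have : ∑ s ∈ T, w s = ∑ s ∈ b.toEnumFinset, s.1.1.toNat + ∑ v ∈ J, v.1.toNat :=
      Finset.sum_disjSum _ _ _
    rw [this, hb]
    exact (Nat.add_le_add_right hba' _).trans hle
  obtain ⟨B, hBP, hBw, hBd⟩ := exists_disjoint_finsets k w P T hT
  have hBmem : ∀ s ∈ T, wedge e (B s).toList ∈ kStarComponent e k (w s) := fun s hs => by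
    rw [← hBw s hs]; exact wedge_toList_mem_kStarComponent e k (B s)
  have hodd : ∀ v, Odd (B (Sum.inr v)).card := fun v => (hBP _).2 trivial
  have heven : ∀ s, Even (B (Sum.inl s)).toList.length := fun s => by
    rw [Finset.length_toList, ← Nat.not_odd_iff_even]; exact fun h => (hBP _).1 h
  let m : (ℤ × ℕ) × ℕ → Subalgebra.center F (ExteriorAlgebra F L) := fun s =>
    if s ∈ b.toEnumFinset then ⟨wedge e (B (Sum.inl s)).toList,
      Subalgebra.mem_center_iff.2 fun y => (wedge_commute_of_even e (heven s) y).eq.symm⟩ else 0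
  have hm : ∀ s ∈ b.toEnumFinset,
      (m s : ExteriorAlgebra F L) = wedge e (B (Sum.inl s)).toList := fun s hs => by
    simp only [m, if_pos hs]
  have hmsq : ∀ s, m s * m s = 0 := fun s => by
    by_cases hsb : s ∈ b.toEnumFinset
    · have hmem := Multiset.mem_of_mem_toEnumFinset hsb
      have h1 := hnn s.1 (Or.inl (hba _ hmem))
      have h2 := (Multiset.mem_filter.1 hmem).2
      have hcard := hBw (Sum.inl s) (Finset.inl_mem_disjSum.2 hsb)
      have hpos : 0 < w (Sum.inl s) := by simp only [w, Sum.elim_inl]; omega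
      rw [← hcard, Finset.card_pos] at hpos
      obtain ⟨i, hi⟩ := hpos
      apply Subtype.ext
      rw [MulMemClass.coe_mul, hm s hsb, ← wedge_append]
      refine wedge_of_not_nodup e fun h => ?_
      have hi' := Finset.mem_toList.2 (Finset.mem_of_mem_filter i hi)
      exact List.disjoint_of_nodup_append h hi' hi'
    · simp only [m, if_neg hsb, mul_zero]
  let z : ℤ × ℕ → Subalgebra.center F (ExteriorAlgebra F L) := fun v =>
    if v.1 = 0 then 1 else ∑ i ∈ Finset.range (b.count v), m (v, i)
  let x : ℤ × ℕ → ExteriorAlgebra F L := fun v =>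
    if v ∈ J then wedge e (B (Sum.inr v)).toList else 0
  have hz : ∀ v y, Commute (z v : ExteriorAlgebra F L) y := fun v y =>
    (Subalgebra.mem_center_iff.1 (z v).2 y).symm
  have hx : ∀ v, x v ∈ oddSpan e := fun v => by
    simp only [x]
    split_ifs
    · exact wedge_mem_oddSpan e (by simpa using hodd v)
    · exact Submodule.zero_mem _
  refine ⟨fun v => z v + x v, fun v => Submodule.add_mem _ ?_ ?_, fun v hv r => ?_, ?_⟩
  · simp only [z]
    split_ifs with h0
    · rw [h0]; exact one_mem_kStarComponent e k
    · rw [AddSubmonoidClass.coe_finsetSum]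
      refine Submodule.sum_mem _ fun i hi => ?_
      have hmem : (v, i) ∈ b.toEnumFinset :=
        (Multiset.mem_toEnumFinset _ _).2 (Finset.mem_range.1 hi)
      have := hBmem (Sum.inl (v, i)) (Finset.inl_mem_disjSum.2 hmem)
      rw [hm _ hmem]
      have hv : ((v.1.toNat : ℕ) : ℤ) = v.1 := Int.toNat_of_nonneg
        (hnn v (Or.inl (hba _ (Multiset.mem_of_mem_toEnumFinset hmem))))
      simpa only [w, Sum.elim_inl, hv] using this
  · simp only [x]
    split_ifs with hv
    · have := hBmem (Sum.inr v) (Finset.inr_mem_disjSum.2 hv)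
      simpa only [w, Sum.elim_inr, Int.toNat_of_nonneg (hnn v (Or.inr hv))] using this
    · exact Submodule.zero_mem _
  · have : x v = 0 := if_neg hv
    simpa [this] using hz v r
  · let L₁ := b.toEnumFinset.toList.flatMap fun s => (B (Sum.inl s)).toList
    let L₂ := J.toList.flatMap fun v => (B (Sum.inr v)).toList
    have hM : (J.toList.map x).prod = wedge e L₂ := by
      rw [wedge_flatMap]
      congr 1
      refine List.map_congr_left fun v hv => ?_
      simp only [x, if_pos (Finset.mem_toList.1 hv)]
    have hxM : ∀ v, x v * wedge e L₂ = 0 := fun v => by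
      by_cases hv : v ∈ J
      · simp only [x, if_pos hv]
        rw [← wedge_append]
        refine wedge_of_not_nodup e fun h => ?_
        obtain ⟨i, hi⟩ := Finset.card_pos.1 (hodd v).pos
        exact List.disjoint_of_nodup_append h (Finset.mem_toList.2 hi)
          (List.mem_flatMap.2 ⟨v, Finset.mem_toList.2 hv, Finset.mem_toList.2 hi⟩)
      · simp only [x, if_neg hv, zero_mul]
    have hzb : (a.map z).prod = (b.map z).prod := by
      conv_lhs => rw [← Multiset.filter_add_not (fun v : ℤ × ℕ => v.1 ≠ 0) a, Multiset.map_add,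
        Multiset.prod_add]
      rw [Multiset.prod_eq_one (s := Multiset.map z (Multiset.filter (fun v => ¬ v.1 ≠ 0) a)),
        mul_one]
      intro c hc
      obtain ⟨v, hv, rfl⟩ := Multiset.mem_map.1 hc
      exact if_pos (not_not.1 (Multiset.mem_filter.1 hv).2)
    let N : ℕ := ∏ v ∈ b.toFinset, (b.count v).factorial
    have hzprod : (b.map z).prod = N * ∏ s ∈ b.toEnumFinset, m s := by
      rw [Nat.cast_prod, ← prod_map_sum_range_of_sq_zero hmsq b]
      congr 1
      exact Multiset.map_congr rfl fun v hv => if_neg (Multiset.mem_filter.1 hv).2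
    have hL₁ : ((∏ s ∈ b.toEnumFinset, m s : Subalgebra.center F (ExteriorAlgebra F L)) :
        ExteriorAlgebra F L) = wedge e L₁ := by
      rw [← Finset.prod_map_toList, wedge_flatMap, SubmonoidClass.coe_list_prod, List.map_map]
      congr 1
      exact List.map_congr_left fun s hs => hm s (Finset.mem_toList.1 hs)
    have hza : (a.toList.map fun v => (z v : ExteriorAlgebra F L)).prod = (N : F) • wedge e L₁ := by
      have : (a.toList.map fun v => (z v : ExteriorAlgebra F L)).prod
          = ((a.map z).prod : Subalgebra.center F (ExteriorAlgebra F L)) := by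
        rw [← Multiset.prod_map_toList, SubmonoidClass.coe_list_prod, List.map_map]
        rfl
      rw [this, hzb, hzprod, MulMemClass.coe_mul, hL₁, Nat.cast_smul_eq_nsmul, nsmul_eq_mul]
      rfl
    have hN : (N : F) ≠ 0 := by
      intro h0
      rw [CharP.cast_eq_zero_iff F p, hp.prime.dvd_finsetProd_iff] at h0
      obtain ⟨v, hv, hdvd⟩ := h0
      have hvb := Multiset.mem_toFinset.1 hv
      have h1 := hnn v (Or.inl (hba _ hvb))
      have h2 := (Multiset.mem_filter.1 hvb).2
      have h3 := hs.count_lt v (hba _ hvb) (by omega)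
      have h4 : b.count v ≤ a.count v := Multiset.count_le_of_le v (Multiset.filter_le _ a)
      exact absurd ((hp.dvd_factorial).1 hdvd) (by simp only at h3; omega)
    have h2 : (2 : F) ≠ 0 := two_ne_zero_of_two_lt_charP p hp2
    have hnodup : (L₁ ++ L₂).Nodup := by
      have : L₁ ++ L₂ = (b.toEnumFinset.toList.map Sum.inl ++ J.toList.map Sum.inr).flatMap
          fun s => (B s).toList := by
        simp [L₁, L₂, List.flatMap_append, List.flatMap_map]
      rw [this, List.nodup_flatMap]
      refine ⟨fun s _ => Finset.nodup_toList _, ?_⟩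
      have hnd : (b.toEnumFinset.toList.map (Sum.inl (β := ℤ × ℕ)) ++
          J.toList.map Sum.inr).Nodup := by
        rw [List.nodup_append]
        refine ⟨(Finset.nodup_toList _).map Sum.inl_injective,
          (Finset.nodup_toList _).map Sum.inr_injective, by simp⟩
      refine List.Pairwise.imp_of_mem ?_ hnd
      intro s t hs ht hst i hi hj
      have hT' : ∀ s, s ∈ b.toEnumFinset.toList.map (Sum.inl (β := ℤ × ℕ)) ++ J.toList.map Sum.inr
          → s ∈ T := fun s hs => by
        rcases List.mem_append.1 hs with h | h <;> obtain ⟨u, hu, rfl⟩ := List.mem_map.1 h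
        · exact Finset.inl_mem_disjSum.2 (Finset.mem_toList.1 hu)
        · exact Finset.inr_mem_disjSum.2 (Finset.mem_toList.1 hu)
      exact Finset.disjoint_left.1 (hBd s (hT' s hs) t (hT' t ht) hst) (Finset.mem_toList.1 hi)
        (Finset.mem_toList.1 hj)
    have hfinal : normalWord (fun v => (z v : ExteriorAlgebra F L) + x v) (a, J)
        = ((2 : F) ^ (J.toList.length / 2) * N) • wedge e (L₁ ++ L₂) := by
      have hJ : Even J.toList.length := by simpa using hs.even_card
      rw [normalWord, commProd_map_central_add_odd e hz hx _ hJ, mul_smul_comm, hM,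
        list_prod_map_add_mul hxM hz, hza, smul_mul_assoc, smul_smul, wedge_append]
    rw [hfinal]
    exact smul_ne_zero (mul_ne_zero (pow_ne_zero _ h2) hN) (wedge_ne_zero e hnodup)

/-- A graded identity of `E^{k*}` that is a combination of admissible normal words is trivial.
Among the words that occur, take one whose commutator part `J` is smallest: the substitution that
does not annihilate it kills every word whose commutator part differs from `J`, and scaling the
variables separates the remaining ones by their multidegrees. -/
theorem eq_zero_of_isGradedIdentity_linearCombination [Infinite F] (p : ℕ) (hp : p.Prime)
    (hp2 : 2 < p) [CharP F p] (k : ℕ) (c : Multiset (ℤ × ℕ) × Finset (ℤ × ℕ) →₀ F)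
    (hc : ∀ s ∈ c.support, IsAdmissible p k s)
    (h : IsGradedIdentity (kStarComponent e k)
      (Finsupp.linearCombination F (normalWord (FreeAlgebra.ι F)) c)) : c = 0 := by
  classical
  by_contra hc0
  obtain ⟨s, hs, hmin⟩ := Finset.exists_min_image c.support (fun s => s.2.card)
    (Finsupp.support_nonempty_iff.2 hc0)
  obtain ⟨y, hy, hcent, hne⟩ := exists_normalWord_ne_zero e p hp hp2 k (hc s hs)
  have hkill : ∀ t ∈ c.support, t.2 ≠ s.2 → normalWord y t = 0 := fun t ht hts => by
    have hns : ¬ t.2 ⊆ s.2 := fun hsub => hts (Finset.eq_of_subset_of_card_le hsub (hmin t ht))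
    obtain ⟨v, hvt, hvs⟩ := Finset.not_subset.1 hns
    rw [normalWord, commProd_of_mem_center (lie_lie_eq_zero e)
      (List.mem_map.2 ⟨v, Finset.mem_toList.2 hvt, rfl⟩) (hcent v hvs), mul_zero]
  obtain ⟨φ, hφ⟩ : ∃ φ : Module.Dual F (ExteriorAlgebra F L), φ (normalWord y s) ≠ 0 := by
    by_contra hcon
    push Not at hcon
    exact hne ((Module.forall_dual_apply_eq_zero_iff F _).1 hcon)
  let d : Multiset (ℤ × ℕ) × Finset (ℤ × ℕ) → (ℤ × ℕ →₀ ℕ) := fun t =>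
    Multiset.toFinsupp (t.1 + t.2.val)
  let Q : MvPolynomial (ℤ × ℕ) F :=
    ∑ t ∈ c.support, MvPolynomial.monomial (d t) (c t * φ (normalWord y t))
  have hQ : Q = 0 := by
    refine MvPolynomial.funext fun r => ?_
    have := h (fun v => r v • y v) fun v => Submodule.smul_mem _ _ (hy v)
    rw [Finsupp.linearCombination_apply, Finsupp.sum, map_sum] at this
    have := congrArg φ this
    rw [map_sum, map_zero] at this
    rw [map_zero, ← this, map_sum]
    refine Finset.sum_congr rfl fun t _ => ?_
    have hev : FreeAlgebra.lift F (fun v => r v • y v) (normalWord (FreeAlgebra.ι F) t)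
        = normalWord (fun v => r v • y v) t := by
      refine (map_normalWord (FreeAlgebra.lift F fun v => r v • y v).toRingHom _ t).trans ?_
      congr 1
      funext v
      exact FreeAlgebra.lift_ι_apply _ v
    have hprod : ((d t).prod fun v n => r v ^ n) = ((t.1 + t.2.val).map r).prod := by
      simp only [d]
      generalize t.1 + t.2.val = M
      rw [Finset.prod_multiset_map_count]
      simp [Finsupp.prod]
    rw [map_smul, map_smul, hev, normalWord_smul, map_smul, MvPolynomial.eval_monomial, hprod,
      smul_eq_mul, smul_eq_mul]
    ring
  have hcoeff : MvPolynomial.coeff (d s) Q = c s * φ (normalWord y s) := by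
    rw [MvPolynomial.coeff_sum, Finset.sum_eq_single s]
    · rw [MvPolynomial.coeff_monomial, if_pos rfl]
    · intro t ht hts
      rw [MvPolynomial.coeff_monomial]
      split_ifs with hd
      · by_cases h2 : t.2 = s.2
        · have h1 := Multiset.toFinsupp.injective hd
          rw [h2] at h1
          exact absurd (Prod.ext (add_right_cancel h1) h2) hts
        · rw [hkill t ht h2, map_zero, mul_zero]
      · rfl
    · exact fun hs' => absurd hs hs'
  rw [hQ, MvPolynomial.coeff_zero] at hcoeff
  exact mul_ne_zero (Finsupp.mem_support_iff.1 hs) hφ hcoeff.symm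

end Independence

theorem mainTheorem2 {F L : Type*} [Field F] [Infinite F] [AddCommGroup L] [Module F L]
    (e : Module.Basis ℕ F L) (p : ℕ) (hp : p.Prime) (hp2 : 2 < p) [CharP F p] (k : ℕ) :
    (k < p →
      gradedIdentities (kStarComponent e k) =
        tzIdealSpan (outerVariables F k ∪ tripleCommutators F)) ∧
    (p ≤ k →
      gradedIdentities (kStarComponent e k) =
        tzIdealSpan (outerVariables F k ∪ tripleCommutators F ∪ powerIdentities F p k)) := by
  have main : gradedIdentities (kStarComponent e k) =
      tzIdealSpan (outerVariables F k ∪ tripleCommutators F ∪ powerIdentities F p k) := by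
    have hle := tzIdealSpan_le_gradedIdentities e p hp hp2 k
    refine le_antisymm (fun f hf => ?_) hle
    have hS := subset_tzIdealSpan
      (outerVariables F k ∪ tripleCommutators F ∪ powerIdentities F p k)
    obtain ⟨c, hc, hfc⟩ := exists_sub_linearCombination_mem hp.pos k (isTZIdeal_tzIdealSpan _)
      (fun g hg => hS (Or.inl (Or.inl hg))) (fun g hg => hS (Or.inl (Or.inr hg)))
      (fun g hg => hS (Or.inr hg)) f
    have hid := TwoSidedIdeal.sub_mem _ hf (hle hfc)
    rw [sub_sub_cancel, mem_gradedIdentities] at hid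
    rwa [eq_zero_of_isGradedIdentity_linearCombination e p hp hp2 k c hc hid, map_zero,
      sub_zero] at hfc
  refine ⟨fun hk => ?_, fun _ => main⟩
  -- if `k < p`, no `t ≥ 1` satisfies `p * t ≤ k`
  have hempty : powerIdentities F p k = ∅ := by
    refine Set.eq_empty_of_forall_notMem ?_
    rintro _ ⟨t, j, ht, hle, -⟩
    have := Nat.le_mul_of_pos_right p (Finset.mem_Icc.1 ht).1
    omega
  rw [main, hempty, Set.union_empty]
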